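/- **Continuity of $s$-minimal sets for domains with outward singularities.** Let $n\ge 2$, $s\in(0,1)$. Write points of $\mathbb{R}^{n+1}$ as $X=(x,x_{n+1})$ with $x=(x',x_n)\in\mathbb{R}^{n-1}\times\mathbb{R}$, and let $B_r=\{x\in\mathbb{R}^n:|x|<r\}$, $C_r=B_r\times\mathbb{R}$. For measurable $A,B,E\subseteq\mathbb{R}^{n+1}$ and open $U\subseteq\mathbb{R}^{n+1}$ let $$L_s(A,B)=\iint_{A\times B}\frac{dX\,dY}{|X-Y|^{n+1+s}},$$ $$\operatorname{Per}_s(E,U)=L_s(E\cap U,E^c\cap U)+L_s(E\cap U,E^c\cap U^c)+L_s(E\cap U^c,E^c\cap U).$$ A measurable set $E$ is called $s$-minimal in an open set $\Omega\subseteq\mathbb{R}^{n+1}$ if for every bounded open $\Omega'\subseteq\Omega$ one has $\operatorname{Per}_s(E,\Omega')<+\infty$ and $\operatorname{Per}_s(E,\Omega')\le\operatorname{Per}_s(F,\Omega')$ for all measurable $F\subseteq\mathbb{R}^{n+1}$ with $F\setminus\Omega'=E\setminus\Omega'$. Let $\omega\subset\mathbb{R}^n$ be open and bounded, and $\Omega=\omega\times\mathbb{R}$.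 Suppose that there exist $\rho>0$, $c>0$, $\beta\in(0,s+1]$ and $\varphi:\mathbb{R}^{n-1}\to[0,+\infty)$ with $\varphi(0)=0$, $\varphi(x')\ge c|x'|^\beta$ for all $|x'|<\rho$, and $$\omega\cap B_\rho=\{x_n>\varphi(x')\}\cap B_\rho.$$ Let $E_0=\{x_{n+1}<\psi(x)\}$ for some $\psi\in L^\infty_{\rm loc}(\mathbb{R}^n)$ with $\psi(x)\le 0$ for all $x\in B_\rho$. Let $E$ be an $s$-minimal set in $\Omega$ with $E\setminus\Omega=E_0\setminus\Omega$. Then, for every $\varepsilon>0$ there exists $\delta>0$ such that $$E\cap C_\delta\subseteq\{x_{n+1}\le\varepsilon\},$$ where, as minimality only determines $E$ in $\Omega$ up to null sets, the inclusion is understood as follows: it holds up to a set of measure zero, and it holds for every point as soon as $|E\cap\mathcal{B}_r(X)|>0$ for all $X\in E\cap\Omega$ and $r>0$, where $\mathcal{B}_r(X)$ is the ball of $\mathbb{R}^{n+1}$ (a property that every $E$ acquires after removal of a null subset of $\Omega$). -/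

import Mathlib

open MeasureTheory Set Metric
open scoped ENNReal

noncomputable section

/-- Euclidean space of dimension `N`. -/
abbrev RSp (N : ℕ) : Type := EuclideanSpace ℝ (Fin N)

/-- The point made of all the coordinates of `x` except the last one. -/
def initCoord {k : ℕ} (x : RSp (k + 1)) : RSp k :=
  WithLp.toLp 2 (fun i : Fin k => x i.castSucc)

/-- The last coordinate of `x`. -/
def lastCoord {k : ℕ} (x : RSp (k + 1)) : ℝ := x (Fin.last k)

/-- The vertical cylinder with base `ω`, that is `ω × ℝ`. -/
def vertCylinder {k : ℕ} (ω : Set (RSp k)) : Set (RSp (k + 1)) :=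
  {X | initCoord X ∈ ω}

/-- The open subgraph of `ψ`. -/
def subgraph {k : ℕ} (ψ : RSp k → ℝ) : Set (RSp (k + 1)) :=
  {X | lastCoord X < ψ (initCoord X)}

/-- The nonlocal interaction of `A` and `B`: the integral over `A × B` of `|x - y| ^ (-(N + s))`,
a value in `[0, ∞]`. (The value of the integrand at `x = y` plays no role, since points are
negligible in positive dimension.) -/
def interaction {N : ℕ} (s : ℝ) (A B : Set (RSp N)) : ℝ≥0∞ :=
  ∫⁻ x in A, ∫⁻ y in B, ENNReal.ofReal (1 / ‖x - y‖ ^ ((N : ℝ) + s))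

/-- The `s`-perimeter of `E` in `Ω`. -/
def sPerimeter {N : ℕ} (s : ℝ) (E Ω : Set (RSp N)) : ℝ≥0∞ :=
  interaction s (E ∩ Ω) (Eᶜ ∩ Ω) + interaction s (E ∩ Ω) (Eᶜ ∩ Ωᶜ)
    + interaction s (E ∩ Ωᶜ) (Eᶜ ∩ Ω)

/-- `s`-minimal sets in a bounded set `Ω`: the `s`-perimeter in `Ω` is finite and is not larger
than that of any (Lebesgue measurable) competitor that agrees with `E` outside `Ω`. -/
def IsSMinimalBdd {N : ℕ} (s : ℝ) (E Ω : Set (RSp N)) : Prop :=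
  sPerimeter s E Ω < ∞ ∧
    ∀ F : Set (RSp N), NullMeasurableSet F volume → E \ Ω = F \ Ω →
      sPerimeter s E Ω ≤ sPerimeter s F Ω

/-- `s`-minimal sets in a possibly unbounded open set `Ω`: (Lebesgue measurable) sets which are
`s`-minimal in every bounded open set contained in `Ω`. -/
def IsSMinimal {N : ℕ} (s : ℝ) (E Ω : Set (RSp N)) : Prop :=
  NullMeasurableSet E volume ∧
    ∀ Ω' : Set (RSp N), IsOpen Ω' → Bornology.IsBounded Ω' → Ω' ⊆ Ω → IsSMinimalBdd s E Ω'

/-- Locally (essentially) bounded measurable functions. -/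
def MemLinftyLoc {k : ℕ} (ψ : RSp k → ℝ) : Prop :=
  ∀ K : Set (RSp k), IsCompact K → MemLp ψ ∞ (volume.restrict K)

/-- The representative `E` has no negligible parts in `Ω`: every point of `E ∩ Ω` sees a set of
positive measure of points of `E` at every scale. It can be achieved by removing from `E` a null
subset of `Ω`, and it follows from the usual convention that the topological boundary of `E` is
made of the points `X` with `0 < |E ∩ B_r(X)| < |B_r(X)|` for all `r > 0`. -/
def NoNegligiblePart {N : ℕ} (E Ω : Set (RSp N)) : Prop :=
  ∀ X ∈ E ∩ Ω, ∀ r : ℝ, 0 < r → 0 < volume (E ∩ ball X r)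

end

/-! The proof is a nonlocal calibration. Fix p = (0, t) with t > ε and foliate by the level sets of
u(X) = x_n + |X - p|². As x_n > φ ≥ 0 in ω ∩ B_ρ, the part U of the cylinder over ω ∩ B_ρ where u <
η lies within √η of p. The set D of points of positive height over B_ρ \ ω misses E, because the
exterior datum is nonpositive there.

For small η, every x in U sees x + z and x - z in D for all z in a piece, away from the origin, of
the cusp |z_n| ≤ c₁ z_1^(1+s); this uses β ≤ 1 + s. Each dyadic piece of that cusp carries at least
a fixed kernel mass (`le_lintegral_fracKernel_box`), so a finite piece outweighs everything adverse:
the far field, and the gap between two tangent paraboloids, whose piece at scale b weighs at most a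
multiple of b^(1-s). Hence the nonlocal curvature of every leaf is at least 1
(`truncKernel_curvature_ge`).

Put A = E ∩ U. Minimality against E \ U gives L(A, Eᶜ) ≤ L(A, E \ U). Integrating the curvature
bound over A, the interactions between higher and lower points of A cancel by symmetry, which leaves
L(A, E \ U) + |A| ≤ L(A, Eᶜ). So |A| = 0 (`IsSMinimalBdd.volume_inter_eq_zero`). Since η does not
depend on t, countably many such sets U cover the part of the cylinder over ω that is near the axis
and above height ε. -/

/-! ### Kernel masses: far field, thin gaps and cusps -/

/-- The kernel of the `s`-perimeter. -/
noncomputable def fracKernel {N : ℕ} (s : ℝ) (z : RSp N) : ℝ≥0∞ :=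
  ENNReal.ofReal (1 / ‖z‖ ^ ((N : ℝ) + s))

theorem measurable_fracKernel {N : ℕ} (s : ℝ) :
    Measurable (fracKernel s : RSp N → ℝ≥0∞) := by
  unfold fracKernel
  fun_prop

theorem fracKernel_neg {N : ℕ} (s : ℝ) (z : RSp N) : fracKernel s (-z) = fracKernel s z := by
  simp [fracKernel]

theorem fracKernel_le {N : ℕ} {s : ℝ} (hs : 0 < s) {z : RSp N} {a : ℝ} (ha : 0 < a)
    (h : a ≤ ‖z‖) : fracKernel s z ≤ ENNReal.ofReal (1 / a ^ ((N : ℝ) + s)) := by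
  apply ENNReal.ofReal_le_ofReal
  gcongr

theorem le_fracKernel {N : ℕ} {s : ℝ} (hs : 0 < s) {z : RSp N} {a : ℝ} (hz : 0 < ‖z‖)
    (h : ‖z‖ ≤ a) : ENNReal.ofReal (1 / a ^ ((N : ℝ) + s)) ≤ fracKernel s z := by
  apply ENNReal.ofReal_le_ofReal
  gcongr

theorem lintegral_fracKernel_compl_ball_lt_top {N : ℕ} {s : ℝ} (hs : 0 < s) {r : ℝ} (hr : 0 < r) :
    ∫⁻ z in {z : RSp N | r ≤ ‖z‖}, fracKernel s z < ∞ := by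
  have h1 := finite_integral_one_add_norm (E := RSp N) (μ := volume) (r := (N : ℝ) + s)
    (by simp; linarith)
  -- For ‖z‖ ≥ r, 1 + ‖z‖ ≤ (1 / r + 1) ‖z‖.
  set K := ENNReal.ofReal ((1 / r + 1) ^ ((N : ℝ) + s)) with hK
  calc ∫⁻ z in {z : RSp N | r ≤ ‖z‖}, fracKernel s z
      ≤ ∫⁻ z in {z : RSp N | r ≤ ‖z‖}, K * ENNReal.ofReal ((1 + ‖z‖) ^ (-((N : ℝ) + s))) := by
        refine setLIntegral_mono' (measurableSet_le measurable_const measurable_norm) ?_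
        intro z hz
        have hz : r ≤ ‖z‖ := hz
        have hz0 : 0 < ‖z‖ := hr.trans_le hz
        rw [hK, ← ENNReal.ofReal_mul (by positivity)]
        apply ENNReal.ofReal_le_ofReal
        rw [Real.rpow_neg (by positivity), ← div_eq_mul_inv,
          ← Real.div_rpow (by positivity) (by positivity), one_div,
          ← Real.inv_rpow (by positivity)]
        refine Real.rpow_le_rpow (by positivity) ?_ (by positivity)
        rw [inv_eq_one_div, div_le_div_iff₀ hz0 (by positivity)]
        have : 1 ≤ 1 / r * ‖z‖ := by
          rw [one_div, inv_mul_eq_div, le_div_iff₀ hr]; linarith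
        linarith
    _ ≤ ∫⁻ z : RSp N, K * ENNReal.ofReal ((1 + ‖z‖) ^ (-((N : ℝ) + s))) :=
        setLIntegral_le_lintegral _ _
    _ = K * ∫⁻ z : RSp N, ENNReal.ofReal ((1 + ‖z‖) ^ (-((N : ℝ) + s))) :=
        lintegral_const_mul _ (by fun_prop)
    _ < ∞ := ENNReal.mul_lt_top ENNReal.ofReal_lt_top h1

theorem measurableSet_coordBox {N : ℕ} {I : Fin N → Set ℝ} (hI : ∀ j, MeasurableSet (I j)) :
    MeasurableSet {z : RSp N | ∀ j, z j ∈ I j} := by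
  rw [ofPred_forall]
  exact MeasurableSet.iInter fun j => (hI j).preimage (by fun_prop)

theorem volume_coordBox {N : ℕ} {I : Fin N → Set ℝ} (hI : ∀ j, MeasurableSet (I j)) :
    volume {z : RSp N | ∀ j, z j ∈ I j} = ∏ j, volume (I j) := by
  rw [← volume_pi_pi, ← (PiLp.volume_preserving_ofLp (Fin N)).measure_preimage
    (MeasurableSet.univ_pi hI).nullMeasurableSet]
  congr 1
  ext z
  simp

theorem abs_coord_le_norm {N : ℕ} (z : RSp N) (j : Fin N) : |z j| ≤ ‖z‖ := by
  simpa using PiLp.norm_apply_le z j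

theorem norm_le_of_abs_coord_le {N : ℕ} {z : RSp N} {a : ℝ} (ha : 0 ≤ a) (h : ∀ j, |z j| ≤ a) :
    ‖z‖ ≤ N * a := by
  rw [EuclideanSpace.norm_eq]
  apply Real.sqrt_le_iff.2 ⟨by positivity, ?_⟩
  calc ∑ j, ‖z j‖ ^ 2 ≤ ∑ _j : Fin N, a ^ 2 := by
        apply Finset.sum_le_sum
        intro j _
        have := h j
        rw [Real.norm_eq_abs]
        gcongr
    _ = N * a ^ 2 := by simp
    _ ≤ (N * a) ^ 2 := by
        rw [mul_pow]
        have : (N : ℝ) ≤ (N : ℝ) ^ 2 := by exact_mod_cast Nat.le_self_pow (by norm_num) N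
        gcongr

/-- The set fits in a box with sides 2b, except 4b² in direction i, so its volume is of order
b^(N+1), while the kernel is of order b^(-N-s). -/
theorem lintegral_fracKernel_thin_annulus_le {N : ℕ} {s : ℝ} (hs : 0 < s) (i : Fin N) {b : ℝ}
    (hb : 0 < b) :
    ∫⁻ z in {z : RSp N | |z i| ≤ 2 * ‖z‖ ^ 2 ∧ b / 2 ≤ ‖z‖ ∧ ‖z‖ ≤ b}, fracKernel s z ≤
      ENNReal.ofReal (2 ^ ((N : ℝ) + 2 + (N + s)) * b ^ (1 - s)) := by
  set a : Fin N → ℝ := fun j => b * (if j = i then 2 * b else 1) with ha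
  have ha0 : ∀ j, 0 ≤ a j := fun j => by simp only [ha]; split_ifs <;> positivity
  set S := {z : RSp N | |z i| ≤ 2 * ‖z‖ ^ 2 ∧ b / 2 ≤ ‖z‖ ∧ ‖z‖ ≤ b} with hS
  have hSm : MeasurableSet S := by
    have h1 : MeasurableSet {z : RSp N | |z i| ≤ 2 * ‖z‖ ^ 2} :=
      measurableSet_le (by fun_prop) (by fun_prop)
    have h2 : MeasurableSet {z : RSp N | b / 2 ≤ ‖z‖} :=
      measurableSet_le measurable_const measurable_norm
    have h3 : MeasurableSet {z : RSp N | ‖z‖ ≤ b} :=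
      measurableSet_le measurable_norm measurable_const
    exact h1.inter (h2.inter h3)
  have hsub : S ⊆ {z : RSp N | ∀ j, z j ∈ Icc (-(a j)) (a j)} := by
    rintro z ⟨h1, -, h3⟩ j
    rw [mem_Icc, ← abs_le]
    by_cases hj : j = i
    · subst hj
      simp only [ha, if_true]
      have : ‖z‖ ^ 2 ≤ b ^ 2 := by gcongr
      nlinarith
    · simp only [ha, if_neg hj, mul_one]
      exact (abs_coord_le_norm z j).trans h3
  have hvol : volume S ≤ ENNReal.ofReal ((2 * b) ^ N * (2 * b)) := by
    refine (measure_mono hsub).trans ?_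
    rw [volume_coordBox (fun j => measurableSet_Icc)]
    simp only [Real.volume_Icc]
    rw [← ENNReal.ofReal_prod_of_nonneg (fun j _ => by linarith [ha0 j])]
    apply ENNReal.ofReal_le_ofReal
    have : ∀ j, a j - -(a j) = (2 * b) * (if j = i then 2 * b else 1) := fun j => by
      simp only [ha]; ring
    simp_rw [this]
    rw [Finset.prod_mul_distrib]
    simp
  calc ∫⁻ z in S, fracKernel s z
      ≤ ∫⁻ _z in S, ENNReal.ofReal (1 / (b / 2) ^ ((N : ℝ) + s)) :=
        setLIntegral_mono' hSm fun z hz => fracKernel_le hs (by positivity) hz.2.1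
    _ = ENNReal.ofReal (1 / (b / 2) ^ ((N : ℝ) + s)) * volume S := setLIntegral_const _ _
    _ ≤ ENNReal.ofReal (1 / (b / 2) ^ ((N : ℝ) + s)) * ENNReal.ofReal ((2 * b) ^ N * (2 * b)) := by
        gcongr
    _ = ENNReal.ofReal (1 / (b / 2) ^ ((N : ℝ) + s) * ((2 * b) ^ N * (2 * b))) :=
        (ENNReal.ofReal_mul (by positivity)).symm
    _ ≤ _ := by
        apply ENNReal.ofReal_le_ofReal
        have h1 : (2 * b) ^ N * (2 * b) = (2 * b) ^ ((N : ℝ) + 1) := by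
          rw [Real.rpow_add_one (by positivity), Real.rpow_natCast]
        rw [h1, Real.div_rpow hb.le (by norm_num), Real.mul_rpow (by norm_num) hb.le, one_div_div,
          div_mul_eq_mul_div, div_le_iff₀ (by positivity)]
        have h2 : b ^ (1 - s) * b ^ ((N : ℝ) + s) = b ^ ((N : ℝ) + 1) := by
          rw [← Real.rpow_add hb]; congr 1; ring
        have h3 : (2 : ℝ) ^ ((N : ℝ) + s) * 2 ^ ((N : ℝ) + 1) ≤ 2 ^ ((N : ℝ) + 2 + (N + s)) := by
          rw [← Real.rpow_add (by norm_num)]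
          exact Real.rpow_le_rpow_of_exponent_le (by norm_num) (by linarith)
        calc _ = (2 : ℝ) ^ ((N : ℝ) + s) * 2 ^ ((N : ℝ) + 1) * b ^ ((N : ℝ) + 1) := by ring
          _ ≤ 2 ^ ((N : ℝ) + 2 + (N + s)) * b ^ ((N : ℝ) + 1) := by gcongr
          _ = _ := by rw [← h2]; ring

/-- Summing the dyadic annuli gives a geometric series of ratio 2^(s-1), convergent because s < 1.
-/
theorem lintegral_fracKernel_thin_coord_lt_top {N : ℕ} {s : ℝ} (hs : 0 < s) (hs1 : s < 1)
    (i : Fin N) :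
    ∫⁻ z in {z : RSp N | |z i| ≤ 2 * ‖z‖ ^ 2 ∧ ‖z‖ < 1}, fracKernel s z < ∞ := by
  set C : ℝ := 2 ^ ((N : ℝ) + 2 + (N + s)) with hC
  set q : ℝ := (1 / 2) ^ (1 - s) with hq
  have hq0 : 0 ≤ q := by positivity
  have hq1 : q < 1 := Real.rpow_lt_one (by norm_num) (by norm_num) (by linarith)
  set S : ℕ → Set (RSp N) := fun k =>
    {z | |z i| ≤ 2 * ‖z‖ ^ 2 ∧ (1 / 2) ^ k / 2 ≤ ‖z‖ ∧ ‖z‖ ≤ (1 / 2) ^ k} with hS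
  have hsub : {z : RSp N | |z i| ≤ 2 * ‖z‖ ^ 2 ∧ ‖z‖ < 1} ⊆ {0} ∪ ⋃ k, S k := by
    rintro z ⟨h1, h2⟩
    by_cases hz : z = 0
    · exact Or.inl hz
    · right
      obtain ⟨k, hk1, hk2⟩ := exists_nat_pow_near_of_lt_one (norm_pos_iff.2 hz) h2.le
        (y := (1 / 2 : ℝ)) (by norm_num) (by norm_num)
      refine mem_iUnion.2 ⟨k, h1, ?_, hk2⟩
      rw [pow_succ] at hk1
      linarith
  -- The convention 1 / 0 = 0 makes the kernel vanish at the origin.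
  have h0 : ∫⁻ z in ({0} : Set (RSp N)), fracKernel s z = 0 := by
    rw [lintegral_singleton]
    have : (N : ℝ) + s ≠ 0 := by positivity
    simp [fracKernel, Real.zero_rpow this]
  calc ∫⁻ z in {z : RSp N | |z i| ≤ 2 * ‖z‖ ^ 2 ∧ ‖z‖ < 1}, fracKernel s z
      ≤ ∫⁻ z in {0} ∪ ⋃ k, S k, fracKernel s z := lintegral_mono_set hsub
    _ ≤ (∫⁻ z in {0}, fracKernel s z) + ∫⁻ z in ⋃ k, S k, fracKernel s z :=
        lintegral_union_le _ _ _
    _ ≤ 0 + ∑' k, ∫⁻ z in S k, fracKernel s z := by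
        rw [h0]
        gcongr
        exact lintegral_iUnion_le _ _
    _ ≤ ∑' k : ℕ, ENNReal.ofReal (C * q ^ k) := by
        rw [zero_add]
        refine ENNReal.tsum_le_tsum fun k => ?_
        refine (lintegral_fracKernel_thin_annulus_le hs i (by positivity)).trans_eq ?_
        rw [hq, ← Real.rpow_natCast, ← Real.rpow_natCast, ← Real.rpow_mul (by norm_num),
          ← Real.rpow_mul (by norm_num), mul_comm (k : ℝ)]
    _ = ENNReal.ofReal (∑' k : ℕ, C * q ^ k) := by
        rw [ENNReal.ofReal_tsum_of_nonneg (fun k => by positivity)]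
        exact (summable_geometric_of_lt_one hq0 hq1).mul_left C
    _ < ∞ := ENNReal.ofReal_lt_top

/-- The thin region between a pair of tangent paraboloids has finite kernel mass, bounded
independently of the common normal direction. -/
theorem lintegral_fracKernel_thin_le {N : ℕ} {s : ℝ} (i : Fin N)
    {v : RSp N} (hv : 1 / 2 ≤ ‖v‖) :
    ∫⁻ z in {z : RSp N | |inner ℝ v z| ≤ ‖z‖ ^ 2 ∧ ‖z‖ < 1}, fracKernel s z ≤
      ∫⁻ z in {z : RSp N | |z i| ≤ 2 * ‖z‖ ^ 2 ∧ ‖z‖ < 1}, fracKernel s z := by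
  have hv0 : 0 < ‖v‖ := by linarith
  -- Coordinates in an orthonormal basis with i-th vector v / ‖v‖ preserve norm and volume; the
  -- factor 2 comes from ‖v‖ ≥ 1 / 2.
  obtain ⟨b, hb⟩ := Orthonormal.exists_orthonormalBasis_extension_of_card_eq (𝕜 := ℝ)
    (E := RSp N) (ι := Fin N) (by simp) (v := fun _ => ‖v‖⁻¹ • v) (s := {i}) (by
      constructor
      · intro j
        simp [norm_smul, hv0.ne']
      · intro j k hjk
        exact absurd (Subsingleton.elim j k) hjk)
  have hb := hb i rfl
  rw [← (b.measurePreserving_repr).setLIntegral_comp_preimage_emb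
    b.repr.toHomeomorph.measurableEmbedding _ {z : RSp N | |z i| ≤ 2 * ‖z‖ ^ 2 ∧ ‖z‖ < 1}]
  simp only [fracKernel, LinearIsometryEquiv.norm_map]
  apply lintegral_mono_set
  rintro z ⟨h1, h2⟩
  refine mem_preimage.2 ⟨?_, by simpa using h2⟩
  rw [b.repr_apply_apply, hb, LinearIsometryEquiv.norm_map, real_inner_smul_left, abs_mul, abs_inv,
    abs_norm, inv_mul_eq_div, div_le_iff₀ hv0]
  nlinarith [sq_nonneg ‖z‖]

/-- A box of side h, thinned to c h^(1+s) in direction j, has volume c h^(N+s), which exactly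
offsets the kernel's h^(-N-s): the bound does not depend on h. -/
theorem le_lintegral_fracKernel_box {N : ℕ} {s : ℝ} (hs : 0 < s) {c : ℝ} (hc : 0 < c)
    (hc1 : c ≤ 1) {i j : Fin N} (hij : i ≠ j) {h : ℝ} (hh : 0 < h) (hh1 : h ≤ 1) :
    ∃ W : Set (RSp N), MeasurableSet W ∧
      (∀ z ∈ W, h < z i ∧ z i < 2 * h ∧ |z j| ≤ c * h ^ (1 + s) ∧ ‖z‖ ≤ N * (2 * h)) ∧
      ENNReal.ofReal (c / (N * 2) ^ ((N : ℝ) + s)) ≤ ∫⁻ z in W, fracKernel s z := by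
  have hN : 0 < N := i.pos
  set I : Fin N → Set ℝ := fun k => if k = i then Ioo h (2 * h) else
    if k = j then Icc (-(c * h ^ (1 + s) / 2)) (c * h ^ (1 + s) / 2) else Icc (-(h / 2)) (h / 2)
    with hI
  have hIm : ∀ k, MeasurableSet (I k) := fun k => by
    simp only [hI]; split_ifs <;> measurability
  have hpow : h ^ (1 + s) = h * h ^ s := by rw [Real.rpow_add hh, Real.rpow_one]
  have hhs : h ^ s ≤ 1 := Real.rpow_le_one hh.le hh1 hs.le
  have hhs0 : 0 < h ^ s := by positivity
  have hcs : c * h ^ (1 + s) ≤ h := by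
    rw [hpow]
    calc c * (h * h ^ s) ≤ 1 * (h * 1) := by gcongr
      _ = h := by ring
  have hcs0 : 0 < c * h ^ (1 + s) := by positivity
  have hW : ∀ z ∈ {z : RSp N | ∀ k, z k ∈ I k},
      h < z i ∧ z i < 2 * h ∧ |z j| ≤ c * h ^ (1 + s) ∧ ‖z‖ ≤ N * (2 * h) := by
    intro z hz
    have hzi := hz i
    simp only [hI, if_true, mem_Ioo] at hzi
    have hzj := hz j
    simp only [hI, if_neg hij.symm, if_true, mem_Icc, ← abs_le] at hzj
    refine ⟨hzi.1, hzi.2, by linarith, norm_le_of_abs_coord_le (by positivity) fun k => ?_⟩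
    have hzk := hz k
    simp only [hI] at hzk
    split_ifs at hzk
    · rw [abs_le]; constructor <;> linarith [hzk.1, hzk.2]
    · rw [mem_Icc, ← abs_le] at hzk; linarith
    · rw [mem_Icc, ← abs_le] at hzk; linarith
  refine ⟨_, measurableSet_coordBox hIm, hW, ?_⟩
  have hvol : volume {z : RSp N | ∀ k, z k ∈ I k} =
      ENNReal.ofReal (h ^ N * (c * h ^ s)) := by
    rw [volume_coordBox hIm]
    have : ∀ k, volume (I k) = ENNReal.ofReal (h * if k = j then c * h ^ s else 1) := by
      intro k
      simp only [hI]
      by_cases hki : k = i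
      · rw [if_pos hki, if_neg (hki ▸ hij), Real.volume_Ioo]; congr 1; ring
      · by_cases hkj : k = j
        · rw [if_neg hki, if_pos hkj, if_pos hkj, Real.volume_Icc, hpow]; congr 1; ring
        · rw [if_neg hki, if_neg hkj, if_neg hkj, Real.volume_Icc]; congr 1; ring
    simp only [this]
    rw [← ENNReal.ofReal_prod_of_nonneg (fun k _ => by split_ifs <;> positivity)]
    rw [Finset.prod_mul_distrib]
    simp
  calc ENNReal.ofReal (c / (N * 2) ^ ((N : ℝ) + s))
      = ENNReal.ofReal (1 / (N * (2 * h)) ^ ((N : ℝ) + s)) *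
          volume {z : RSp N | ∀ k, z k ∈ I k} := by
        rw [hvol, ← ENNReal.ofReal_mul (by positivity), ← mul_assoc (N : ℝ),
          Real.mul_rpow (by positivity) hh.le, Real.rpow_add hh, Real.rpow_natCast]
        congr 1
        field_simp
    _ = ∫⁻ _z in {z : RSp N | ∀ k, z k ∈ I k},
          ENNReal.ofReal (1 / (N * (2 * h)) ^ ((N : ℝ) + s)) := (setLIntegral_const _ _).symm
    _ ≤ _ := by
        refine setLIntegral_mono' (measurableSet_coordBox hIm) fun z hz => le_fracKernel hs ?_ ?_
        · have := hW z hz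
          exact (hh.trans this.1).trans_le ((le_abs_self _).trans (abs_coord_le_norm z i))
        · exact (hW z hz).2.2.2

/-- The cuspidal region `{|z_j| ≤ c z_i ^ (1 + s)}` has infinite kernel mass near the origin;
this mass is already attained on subsets at a positive distance from `{z_i = 0}`. -/
theorem exists_cusp_subset_lintegral_ge {N : ℕ} {s : ℝ} (hs : 0 < s) {c : ℝ} (hc : 0 < c)
    {i j : Fin N} (hij : i ≠ j) {r : ℝ} (hr : 0 < r) {M : ℝ≥0∞} (hM : M ≠ ∞) :
    ∃ h : ℝ, 0 < h ∧ ∃ W : Set (RSp N), MeasurableSet W ∧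
      (∀ z ∈ W, h < z i ∧ |z j| ≤ c * z i ^ (1 + s) ∧ ‖z‖ < r) ∧
      M ≤ ∫⁻ z in W, fracKernel s z := by
  have hN : 0 < N := i.pos
  set c' := min c 1 with hc'
  have hc'0 : 0 < c' := lt_min hc one_pos
  -- Boxes of index at least k₀ lie in the ball of radius r. They are disjoint, as z_i lies between
  -- 2^(-k) and twice that, so n of them suffice once n times the common lower bound exceeds M.
  obtain ⟨k₀, hk₀⟩ := exists_pow_lt_of_lt_one (show 0 < r / (N * 2) by positivity)
    (show (1 / 2 : ℝ) < 1 by norm_num)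
  have hbox : ∀ k : ℕ, _ := fun k => le_lintegral_fracKernel_box hs hc'0 (min_le_right c 1) hij
    (h := (1 / 2) ^ k) (by positivity) (pow_le_one₀ (by norm_num) (by norm_num))
  choose W hWm hW hWint using hbox
  set a := ENNReal.ofReal (c' / (N * 2) ^ ((N : ℝ) + s)) with ha
  have ha0 : a ≠ 0 := by rw [ha]; simp; positivity
  obtain ⟨n, hn⟩ := ENNReal.exists_nat_mul_gt ha0 hM
  have hdisj : Pairwise (Function.onFun Disjoint W) := by
    have key : ∀ k l, k < l → Disjoint (W k) (W l) := by
      intro k l hkl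
      rw [Set.disjoint_left]
      intro z hz hz'
      have h1 := (hW k z hz).1
      have h2 := (hW l z hz').2.1
      have h3 : (1 / 2 : ℝ) ^ l ≤ (1 / 2) ^ (k + 1) :=
        pow_le_pow_of_le_one (by norm_num) (by norm_num) hkl
      rw [pow_succ] at h3
      linarith
    intro k l hkl
    rcases lt_or_gt_of_ne hkl with h | h
    · exact key k l h
    · exact (key l k h).symm
  refine ⟨(1 / 2) ^ (k₀ + n), by positivity, ⋃ k ∈ Finset.Ico k₀ (k₀ + n), W k,
    Finset.measurableSet_biUnion _ (fun k _ => hWm k), ?_, ?_⟩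
  · intro z hz
    simp only [mem_iUnion, Finset.mem_Ico] at hz
    obtain ⟨k, ⟨hk1, hk2⟩, hz⟩ := hz
    obtain ⟨h1, h2, h3, h4⟩ := hW k z hz
    refine ⟨lt_of_le_of_lt (pow_le_pow_of_le_one (by norm_num) (by norm_num) hk2.le) h1, ?_, ?_⟩
    · refine h3.trans ?_
      have : c' ≤ c := min_le_left _ _
      gcongr
    · have h5 : (1 / 2 : ℝ) ^ k ≤ (1 / 2) ^ k₀ :=
        pow_le_pow_of_le_one (by norm_num) (by norm_num) hk1
      have h6 : (1 / 2 : ℝ) ^ k < r / (N * 2) := h5.trans_lt hk₀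
      rw [lt_div_iff₀ (by positivity)] at h6
      linarith
  · rw [lintegral_biUnion_finset (fun k _ l _ hkl => hdisj hkl) (fun k _ => hWm k)]
    calc M ≤ n * a := hn.le
      _ = ∑ _k ∈ Finset.Ico k₀ (k₀ + n), a := by simp
      _ ≤ _ := Finset.sum_le_sum fun k _ => hWint k

/-! ### The truncated kernel -/

/-- The kernel of the `s`-perimeter, truncated near the origin. -/
noncomputable def truncKernel {N : ℕ} (s a : ℝ) (z : RSp N) : ℝ≥0∞ :=
  {z : RSp N | a < ‖z‖}.indicator (fracKernel s) z

theorem measurable_truncKernel {N : ℕ} (s a : ℝ) :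
    Measurable (truncKernel s a : RSp N → ℝ≥0∞) :=
  (measurable_fracKernel s).indicator (measurableSet_lt measurable_const measurable_norm)

theorem truncKernel_neg {N : ℕ} (s a : ℝ) (z : RSp N) :
    truncKernel s a (-z) = truncKernel s a z := by
  simp [truncKernel, indicator, fracKernel_neg]

theorem truncKernel_le {N : ℕ} (s a : ℝ) (z : RSp N) : truncKernel s a z ≤ fracKernel s z :=
  indicator_le_self _ _ _

theorem truncKernel_of_lt {N : ℕ} (s : ℝ) {a : ℝ} {z : RSp N} (h : a < ‖z‖) :
    truncKernel s a z = fracKernel s z :=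
  indicator_of_mem (s := {z : RSp N | a < ‖z‖}) h _

theorem truncKernel_anti {N : ℕ} (s : ℝ) {a b : ℝ} (h : a ≤ b) (z : RSp N) :
    truncKernel s b z ≤ truncKernel s a z :=
  indicator_le_indicator_of_subset (fun _ hz => lt_of_le_of_lt h hz) (fun _ => zero_le) z

theorem lintegral_truncKernel_lt_top {N : ℕ} {s : ℝ} (hs : 0 < s) {a : ℝ} (ha : 0 < a) :
    ∫⁻ z : RSp N, truncKernel s a z < ∞ := by
  refine lt_of_le_of_lt ?_ (lintegral_fracKernel_compl_ball_lt_top (N := N) hs ha)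
  unfold truncKernel
  rw [lintegral_indicator (measurableSet_lt measurable_const measurable_norm)]
  exact lintegral_mono_set fun z (hz : a < ‖z‖) => hz.le

/-- The shift by 2 keeps the truncation radii strictly below a when a > 0, as the calibration
requires. -/
theorem iSup_truncKernel {N : ℕ} {s : ℝ} (hs : 0 < s) {a : ℝ} (z : RSp N) :
    ⨆ n : ℕ, truncKernel s (a / (n + 2)) z = fracKernel s z := by
  apply le_antisymm (iSup_le fun n => truncKernel_le s _ z)
  by_cases hz : z = 0
  · have : (N : ℝ) + s ≠ 0 := by positivity
    simp [hz, fracKernel, Real.zero_rpow this]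
  · have hz' : 0 < ‖z‖ := norm_pos_iff.2 hz
    obtain ⟨n, hn⟩ := exists_nat_gt (a / ‖z‖)
    refine le_trans (le_of_eq ?_) (le_iSup _ n)
    rw [truncKernel_of_lt]
    rw [div_lt_iff₀ hz'] at hn
    rw [div_lt_iff₀ (by positivity)]
    nlinarith

/-! ### Interactions and the perimeter -/

theorem interaction_eq {N : ℕ} (s : ℝ) (A B : Set (RSp N)) :
    interaction s A B = ∫⁻ x in A, ∫⁻ y in B, fracKernel s (x - y) := rfl

theorem measurable_setLIntegral_sub {N : ℕ} {f : RSp N → ℝ≥0∞} (hf : Measurable f)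
    (B : Set (RSp N)) : Measurable fun x => ∫⁻ y in B, f (x - y) :=
  Measurable.lintegral_prod_right' (f := fun p : RSp N × RSp N => f (p.1 - p.2))
    (hf.comp (measurable_fst.sub measurable_snd))

theorem interaction_comm {N : ℕ} (s : ℝ) (A B : Set (RSp N)) :
    interaction s A B = interaction s B A := by
  rw [interaction_eq, interaction_eq, lintegral_lintegral_swap]
  · refine lintegral_congr fun y => lintegral_congr fun x => ?_
    rw [← fracKernel_neg, neg_sub]
  · exact ((measurable_fracKernel s).comp (measurable_fst.sub measurable_snd)).aemeasurable

theorem interaction_congr {N : ℕ} (s : ℝ) {A A' B B' : Set (RSp N)} (hA : A =ᵐ[volume] A')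
    (hB : B =ᵐ[volume] B') : interaction s A B = interaction s A' B' := by
  unfold interaction
  rw [Measure.restrict_congr_set hA, Measure.restrict_congr_set hB]

theorem interaction_union_right {N : ℕ} (s : ℝ) (A : Set (RSp N)) {B B' : Set (RSp N)}
    (hB' : MeasurableSet B') (h : Disjoint B B') :
    interaction s A (B ∪ B') = interaction s A B + interaction s A B' := by
  simp only [interaction_eq, lintegral_union hB' h]
  exact lintegral_add_left (measurable_setLIntegral_sub (measurable_fracKernel s) B) _

theorem sPerimeter_congr {N : ℕ} (s : ℝ) {E E' : Set (RSp N)} (h : E =ᵐ[volume] E')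
    (Ω : Set (RSp N)) : sPerimeter s E Ω = sPerimeter s E' Ω := by
  have h1 : ∀ U, (E ∩ U : Set (RSp N)) =ᵐ[volume] (E' ∩ U : Set (RSp N)) :=
    fun U => h.inter (ae_eq_refl U)
  have h2 : ∀ U, (Eᶜ ∩ U : Set (RSp N)) =ᵐ[volume] (E'ᶜ ∩ U : Set (RSp N)) :=
    fun U => h.compl.inter (ae_eq_refl U)
  unfold sPerimeter
  rw [interaction_congr s (h1 Ω) (h2 Ω), interaction_congr s (h1 Ω) (h2 Ωᶜ),
    interaction_congr s (h1 Ωᶜ) (h2 Ω)]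

/-- Comparing an `s`-minimal set `E` in `Ω` with `E \ Ω`. -/
theorem IsSMinimalBdd.interaction_compl_le {N : ℕ} {s : ℝ} {E E' Ω : Set (RSp N)}
    (hE : IsSMinimalBdd s E Ω) (hEE' : E' =ᵐ[volume] E) (hE' : MeasurableSet E')
    (hΩ : MeasurableSet Ω) :
    interaction s (E' ∩ Ω) E'ᶜ ≤ interaction s (E' ∩ Ω) (E' \ Ω) ∧
      interaction s (E' ∩ Ω) E'ᶜ < ∞ := by
  obtain ⟨hfin, hmin⟩ := hE
  have hEm : NullMeasurableSet E volume := hE'.nullMeasurableSet.congr hEE'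
  have hmin := hmin (E \ Ω) (hEm.diff hΩ.nullMeasurableSet) (by simp)
  rw [← sPerimeter_congr s hEE'] at hmin hfin
  rw [← sPerimeter_congr s (hEE'.diff (ae_eq_refl Ω))] at hmin
  have hF : sPerimeter s (E' \ Ω) Ω = interaction s (E' \ Ω) Ω := by
    have h1 : E' \ Ω ∩ Ω = ∅ := by simp
    have h2 : E' \ Ω ∩ Ωᶜ = E' \ Ω := by ext; simp
    have h3 : (E' \ Ω)ᶜ ∩ Ω = Ω := by ext; simp; tauto
    simp [sPerimeter, h1, h2, h3, interaction]
  have hsplit : interaction s (E' \ Ω) Ω =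
      interaction s (E' ∩ Ω) (E' \ Ω) + interaction s (E' ∩ Ωᶜ) (E'ᶜ ∩ Ω) := by
    rw [interaction_comm s (E' ∩ Ω), ← sdiff_eq, ← interaction_union_right]
    · congr 1; ext; simp; tauto
    · exact hE'.compl.inter hΩ
    · rw [Set.disjoint_left]; rintro x ⟨h, -⟩ ⟨h', -⟩; exact h' h
  have hcompl : interaction s (E' ∩ Ω) E'ᶜ =
      interaction s (E' ∩ Ω) (E'ᶜ ∩ Ω) + interaction s (E' ∩ Ω) (E'ᶜ ∩ Ωᶜ) := by
    rw [← interaction_union_right]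
    · congr 1; ext; simp
    · exact hE'.compl.inter hΩ.compl
    · rw [Set.disjoint_left]; rintro x ⟨-, h⟩ ⟨-, h'⟩; exact h' h
  rw [hF, hsplit] at hmin
  unfold sPerimeter at hmin hfin
  rw [← hcompl] at hmin hfin
  have h3 := ENNReal.add_lt_top.1 hfin
  -- Both perimeters contain the interaction of E' \ Ω with Ω \ E', which is finite and cancels.
  exact ⟨(ENNReal.add_le_add_iff_right h3.2.ne).1 hmin, h3.1⟩

/-! ### The calibration argument -/

/-- The interactions of a point of `A` with the lower and with the higher points of `A` for `u`
balance after integration over `A`. -/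
theorem lintegral_lintegral_sublevel_swap {N : ℕ} {A : Set (RSp N)}
    {u : RSp N → ℝ} (hu : Measurable u) {f : RSp N → ℝ≥0∞} (hf : Measurable f)
    (hf_neg : ∀ z, f (-z) = f z) :
    ∫⁻ x in A, ∫⁻ y in {y | u y < u x} ∩ A, f (x - y) =
      ∫⁻ x in A, ∫⁻ y in {y | u x < u y} ∩ A, f (x - y) := by
  have h1 : ∀ x, ∫⁻ y in {y | u y < u x} ∩ A, f (x - y) =
      ∫⁻ y in A, if u y < u x then f (x - y) else 0 := by
    intro x
    have hm : MeasurableSet {y | u y < u x} := measurableSet_lt hu measurable_const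
    rw [← Measure.restrict_restrict hm, ← lintegral_indicator hm]
    rfl
  have h2 : ∀ x, ∫⁻ y in {y | u x < u y} ∩ A, f (x - y) =
      ∫⁻ y in A, if u x < u y then f (x - y) else 0 := by
    intro x
    have hm : MeasurableSet {y | u x < u y} := measurableSet_lt measurable_const hu
    rw [← Measure.restrict_restrict hm, ← lintegral_indicator hm]
    rfl
  simp only [h1, h2]
  rw [lintegral_lintegral_swap]
  · refine lintegral_congr fun y => lintegral_congr fun x => ?_
    rw [← hf_neg (x - y), neg_sub]
  · refine (Measurable.ite ?_ (hf.comp (measurable_fst.sub measurable_snd))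
      measurable_const).aemeasurable
    exact measurableSet_lt (hu.comp measurable_snd) (hu.comp measurable_fst)

/-- Nonlocal calibration: if `Ω` is foliated by level sets of `u` whose truncated nonlocal mean
curvatures, computed with the set `D` in the complement of `E` and with the worst case elsewhere
outside `Ω`, are at least `1`, then an `s`-minimal set is negligible in `Ω`. -/
theorem IsSMinimalBdd.volume_inter_eq_zero {N : ℕ} {s : ℝ} (hs : 0 < s) {E D Ω : Set (RSp N)}
    (hE : IsSMinimalBdd s E Ω) (hEm : NullMeasurableSet E volume) (hΩ : MeasurableSet Ω)
    (hΩ_fin : volume Ω < ∞) (hDE : Disjoint D E) {u : RSp N → ℝ} (hu : Measurable u)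
    {a₀ : ℝ} (ha₀ : 0 < a₀)
    (h : ∀ x ∈ Ω, ∀ a, 0 < a → a < a₀ →
      (∫⁻ y in {y | y ∉ D ∧ (y ∈ Ω → u x < u y)}, truncKernel s a (x - y)) + 1 ≤
        ∫⁻ y in {y | y ∈ D ∨ (y ∈ Ω ∧ u y < u x)}, truncKernel s a (x - y)) :
    volume (E ∩ Ω) = 0 := by
  -- A measurable representative inside E remains disjoint from D.
  obtain ⟨E', hE'E, hE'm, hEE'⟩ := hEm.exists_measurable_subset_ae_eq
  obtain ⟨hle, hfin⟩ := hE.interaction_compl_le hEE' hE'm hΩ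
  set A := E' ∩ Ω with hA
  have hAm : MeasurableSet A := hE'm.inter hΩ
  have hAfin : volume A < ∞ := (measure_mono inter_subset_right).trans_lt hΩ_fin
  have htrunc : ∀ a, 0 < a → a < a₀ →
      (∫⁻ x in A, ∫⁻ y in E' \ Ω, truncKernel s a (x - y)) + volume A ≤
        interaction s A E'ᶜ := by
    intro a ha haa
    have hkm := measurable_truncKernel (N := N) s a
    set J := ∫⁻ x in A, ∫⁻ y in {y | u x < u y} ∩ A, truncKernel s a (x - y) with hJ
    -- Truncation is needed here: J is to be subtracted from both sides, so it must be finite.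
    have hJfin : J ≠ ∞ := by
      refine (lt_of_le_of_lt (b := ∫⁻ _x in A, ∫⁻ z : RSp N, truncKernel s a z) ?_ ?_).ne
      · refine lintegral_mono fun x => (setLIntegral_le_lintegral _ _).trans_eq ?_
        exact lintegral_sub_left_eq_self _ x
      · rw [setLIntegral_const]
        exact ENNReal.mul_lt_top (lintegral_truncKernel_lt_top hs ha) hAfin
    -- The curvature bound at x: E' \ Ω and the higher points of A count against it, and everything
    -- in its favour lies in the complement of E' or among the lower points of A.
    have hpt : ∀ x ∈ A,
        (∫⁻ y in E' \ Ω, truncKernel s a (x - y)) +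
          ((∫⁻ y in {y | u x < u y} ∩ A, truncKernel s a (x - y)) + 1) ≤
        (∫⁻ y in E'ᶜ, truncKernel s a (x - y)) +
          ∫⁻ y in {y | u y < u x} ∩ A, truncKernel s a (x - y) := by
      intro x hx
      have hm : MeasurableSet ({y | u x < u y} ∩ A) :=
        (measurableSet_lt measurable_const hu).inter hAm
      rw [← add_assoc, ← lintegral_union hm]
      · refine le_trans ?_ ((h x hx.2 a ha haa).trans ?_)
        · gcongr
          rintro y (⟨hy1, hy2⟩ | ⟨hy1, hy2⟩)
          · exact ⟨fun hD => Set.disjoint_left.1 hDE hD (hE'E hy1), fun h => absurd h hy2⟩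
          · exact ⟨fun hD => Set.disjoint_left.1 hDE hD (hE'E hy2.1), fun _ => hy1⟩
        · refine le_trans (lintegral_mono_set ?_) (lintegral_union_le _ _ _)
          rintro y (hy | ⟨hy1, hy2⟩)
          · exact Or.inl fun hyE => Set.disjoint_left.1 hDE hy (hE'E hyE)
          · by_cases hyE : y ∈ E'
            · exact Or.inr ⟨hy2, hyE, hy1⟩
            · exact Or.inl hyE
      · rw [Set.disjoint_left]; rintro y ⟨-, hy⟩ ⟨-, -, hy'⟩; exact hy hy'
    have hint := setLIntegral_mono' (μ := volume) hAm hpt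
    have hmeas := measurable_setLIntegral_sub hkm (E' \ Ω)
    have hmeas' := measurable_setLIntegral_sub hkm E'ᶜ
    rw [lintegral_add_left hmeas, lintegral_add_left hmeas',
      lintegral_add_right _ measurable_const, setLIntegral_const, one_mul,
      lintegral_lintegral_sublevel_swap hu hkm (truncKernel_neg s a), ← hJ, add_comm J,
      ← add_assoc, ENNReal.add_le_add_iff_right hJfin] at hint
    refine hint.trans ?_
    exact lintegral_mono fun x => lintegral_mono fun y => truncKernel_le _ _ _
  -- Monotone convergence removes the truncation on the left; on the right the full kernel is
  -- already an upper bound.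
  have hsup : interaction s A (E' \ Ω) =
      ⨆ n : ℕ, ∫⁻ x in A, ∫⁻ y in E' \ Ω, truncKernel s (a₀ / (n + 2)) (x - y) := by
    have hmono : ∀ {n k : ℕ}, n ≤ k → a₀ / ((k : ℝ) + 2) ≤ a₀ / ((n : ℝ) + 2) := by
      intro n k hnk
      gcongr
    rw [interaction_eq, ← lintegral_iSup]
    · refine lintegral_congr fun x => ?_
      rw [← lintegral_iSup]
      · exact lintegral_congr fun y => (iSup_truncKernel hs _).symm
      · exact fun n => (measurable_truncKernel s _).comp (measurable_const.sub measurable_id)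
      · exact fun n k hnk y => truncKernel_anti s (hmono hnk) _
    · exact fun n => measurable_setLIntegral_sub (measurable_truncKernel s _) _
    · exact fun n k hnk x => lintegral_mono fun y => truncKernel_anti s (hmono hnk) _
  have hfinal : interaction s A (E' \ Ω) + volume A ≤ interaction s A E'ᶜ := by
    rw [hsup, ENNReal.iSup_add]
    refine iSup_le fun n => htrunc _ (by positivity) ?_
    rw [div_lt_iff₀ (by positivity)]
    nlinarith [(Nat.cast_nonneg n : (0 : ℝ) ≤ n)]
  have hzero : volume A = 0 := by
    have h1 := hfinal.trans hle
    have h2 : interaction s A (E' \ Ω) ≠ ∞ :=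
      ((le_self_add.trans hfinal).trans_lt hfin).ne
    have h3 : interaction s A (E' \ Ω) + volume A ≤ interaction s A (E' \ Ω) + 0 := by
      simpa using h1
    exact le_zero_iff.1 ((ENNReal.add_le_add_iff_left h2).1 h3)
  rw [← hzero]
  exact measure_congr (hEE'.symm.inter (ae_eq_refl Ω))

/-! ### Curvature of the leaves -/

/-- Pair x + z on the favourable side with x - z on the adverse side. If ‖z‖ < r and x - z is
adverse but x + z is not favourable, then u does not drop below u x at either point, which forces
|⟨v, z⟩| ≤ ‖z‖². So the unpaired adverse mass is at most that of the far field and of the thin gap.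
For z in W both x + z and x - z lie in D, so W adds favourable mass with no adverse partner. -/
theorem truncKernel_curvature_ge {N : ℕ} {s : ℝ} (i : Fin N) {D Ω W : Set (RSp N)}
    (hD : MeasurableSet D) (hΩ : MeasurableSet Ω) (hWm : MeasurableSet W) {u : RSp N → ℝ}
    (hu : Measurable u) {x v : RSp N} (hv : 1 / 2 ≤ ‖v‖)
    (hux : ∀ z, u (x + z) = u x + inner ℝ v z + ‖z‖ ^ 2) {r : ℝ} (hr1 : r ≤ 1)
    (hball : ∀ z, ‖z‖ < r → x + z ∉ D → u (x + z) ≤ u x → x + z ∈ Ω) {a : ℝ}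
    (hW : ∀ z ∈ W, a < ‖z‖ ∧ x + z ∈ D ∧ x - z ∈ D)
    (hWint : (∫⁻ z in {z : RSp N | r ≤ ‖z‖}, fracKernel s z) +
      (∫⁻ z in {z : RSp N | |z i| ≤ 2 * ‖z‖ ^ 2 ∧ ‖z‖ < 1}, fracKernel s z) + 1 ≤
        ∫⁻ z in W, fracKernel s z) :
    (∫⁻ y in {y | y ∉ D ∧ (y ∈ Ω → u x < u y)}, truncKernel s a (x - y)) + 1 ≤
        ∫⁻ y in {y | y ∈ D ∨ (y ∈ Ω ∧ u y < u x)}, truncKernel s a (x - y) := by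
  have hkm := measurable_truncKernel (N := N) s a
  have hkx : Measurable fun y => truncKernel s a (x - y) :=
    hkm.comp (measurable_const.sub measurable_id)
  have hP : MeasurableSet {y | y ∈ D ∨ (y ∈ Ω ∧ u y < u x)} :=
    hD.union (hΩ.inter (measurableSet_lt hu measurable_const))
  have hNm : MeasurableSet {y | y ∉ D ∧ (y ∈ Ω → u x < u y)} := by
    have : {y | y ∉ D ∧ (y ∈ Ω → u x < u y)} = Dᶜ ∩ (Ωᶜ ∪ {y | u x < u y}) := by
      ext y; simp [imp_iff_not_or]
    rw [this]
    exact hD.compl.inter (hΩ.compl.union (measurableSet_lt measurable_const hu))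
  have hPeq : ∫⁻ y in {y | y ∈ D ∨ (y ∈ Ω ∧ u y < u x)}, truncKernel s a (x - y) =
      ∫⁻ z in (x + ·) ⁻¹' {y | y ∈ D ∨ (y ∈ Ω ∧ u y < u x)}, truncKernel s a z := by
    rw [← (measurePreserving_add_left volume x).setLIntegral_comp_preimage hP hkx]
    simp [truncKernel_neg]
  have hNeq : ∫⁻ y in {y | y ∉ D ∧ (y ∈ Ω → u x < u y)}, truncKernel s a (x - y) =
      ∫⁻ z in (x - ·) ⁻¹' {y | y ∉ D ∧ (y ∈ Ω → u x < u y)}, truncKernel s a z := by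
    rw [← (Measure.measurePreserving_sub_left volume x).setLIntegral_comp_preimage hNm hkx]
    simp
  rw [hPeq, hNeq]
  set P := (x + ·) ⁻¹' {y | y ∈ D ∨ (y ∈ Ω ∧ u y < u x)} with hPdef
  set Q := (x - ·) ⁻¹' {y | y ∉ D ∧ (y ∈ Ω → u x < u y)} with hQdef
  set S := {z : RSp N | |inner ℝ v z| ≤ ‖z‖ ^ 2 ∧ ‖z‖ < 1} with hS
  have hcover : Q ⊆ (Q ∩ P) ∪ ({z | r ≤ ‖z‖} ∪ S) := by
    intro z hz
    by_cases hzr : r ≤ ‖z‖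
    · exact Or.inr (Or.inl hzr)
    push Not at hzr
    by_cases hzP : z ∈ P
    · exact Or.inl ⟨hz, hzP⟩
    refine Or.inr (Or.inr ⟨?_, hzr.trans_le hr1⟩)
    have hzD : x + z ∉ D := fun h => hzP (Or.inl h)
    have h1 : u x ≤ u (x + z) := by
      by_contra! h
      exact hzP (Or.inr ⟨hball z hzr hzD h.le, h⟩)
    have h2 : u x < u (x + -z) := by
      by_contra! h
      have hz' : x - z ∉ D ∧ (x - z ∈ Ω → u x < u (x - z)) := hz
      rw [sub_eq_add_neg] at hz'
      exact absurd (hz'.2 (hball (-z) (by simpa using hzr) hz'.1 h)) h.not_gt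
    rw [hux] at h1 h2
    rw [inner_neg_right, norm_neg] at h2
    rw [abs_le]
    constructor <;> linarith
  have hWQ : Disjoint (Q ∩ P) W := by
    rw [Set.disjoint_left]
    rintro z ⟨hz, -⟩ hzW
    exact hz.1 (hW z hzW).2.2
  have hWP : (Q ∩ P) ∪ W ⊆ P := union_subset inter_subset_right fun z hz => Or.inl (hW z hz).2.1
  have hWtrunc : ∫⁻ z in W, fracKernel s z = ∫⁻ z in W, truncKernel s a z :=
    setLIntegral_congr_fun hWm fun z hz => (truncKernel_of_lt s (hW z hz).1).symm
  calc (∫⁻ z in Q, truncKernel s a z) + 1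
      ≤ ((∫⁻ z in Q ∩ P, truncKernel s a z) +
          ((∫⁻ z in {z | r ≤ ‖z‖}, truncKernel s a z) + ∫⁻ z in S, truncKernel s a z)) + 1 := by
        gcongr
        refine (lintegral_mono_set hcover).trans ((lintegral_union_le _ _ _).trans ?_)
        gcongr
        exact lintegral_union_le _ _ _
    _ ≤ ((∫⁻ z in Q ∩ P, truncKernel s a z) +
          ((∫⁻ z in {z | r ≤ ‖z‖}, fracKernel s z) +
            ∫⁻ z in {z : RSp N | |z i| ≤ 2 * ‖z‖ ^ 2 ∧ ‖z‖ < 1}, fracKernel s z)) + 1 := by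
        refine add_le_add (add_le_add le_rfl (add_le_add ?_ ?_)) le_rfl
        · exact lintegral_mono fun z => truncKernel_le s a z
        · exact (lintegral_mono fun z => truncKernel_le s a z).trans
            (lintegral_fracKernel_thin_le i hv)
    _ ≤ (∫⁻ z in Q ∩ P, truncKernel s a z) + ∫⁻ z in W, truncKernel s a z := by
        rw [add_assoc, ← hWtrunc]
        gcongr
    _ = ∫⁻ z in (Q ∩ P) ∪ W, truncKernel s a z := (lintegral_union hWm hWQ).symm
    _ ≤ _ := lintegral_mono_set hWP

/-! ### Coordinates and the foliating function -/

theorem continuous_initCoord {k : ℕ} : Continuous (initCoord : RSp (k + 1) → RSp k) := by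
  unfold initCoord
  fun_prop

theorem continuous_lastCoord {k : ℕ} : Continuous (lastCoord : RSp (k + 1) → ℝ) := by
  unfold lastCoord
  fun_prop

theorem initCoord_sub {k : ℕ} (x y : RSp (k + 1)) :
    initCoord (x - y) = initCoord x - initCoord y := rfl

theorem lastCoord_sub {k : ℕ} (x y : RSp (k + 1)) :
    lastCoord (x - y) = lastCoord x - lastCoord y := rfl

theorem norm_sq_eq_initCoord_add_lastCoord {k : ℕ} (x : RSp (k + 1)) :
    ‖x‖ ^ 2 = ‖initCoord x‖ ^ 2 + lastCoord x ^ 2 := by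
  rw [EuclideanSpace.norm_sq_eq, EuclideanSpace.norm_sq_eq, Fin.sum_univ_castSucc]
  simp [initCoord, lastCoord]

theorem norm_initCoord_le {k : ℕ} (x : RSp (k + 1)) : ‖initCoord x‖ ≤ ‖x‖ := by
  apply le_of_sq_le_sq _ (norm_nonneg _)
  rw [norm_sq_eq_initCoord_add_lastCoord x]
  nlinarith [sq_nonneg (lastCoord x)]

theorem abs_lastCoord_le {k : ℕ} (x : RSp (k + 1)) : |lastCoord x| ≤ ‖x‖ :=
  abs_coord_le_norm x _

theorem isOpen_vertCylinder {k : ℕ} {ω : Set (RSp k)} (hω : IsOpen ω) :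
    IsOpen (vertCylinder ω) := hω.preimage continuous_initCoord

/-- The function whose sublevel sets foliate the domain near the point of height `t` above the
origin. -/
noncomputable def tiltedParaboloid {m : ℕ} (t : ℝ) (X : RSp (m + 2)) : ℝ :=
  lastCoord (initCoord X) + ‖X - EuclideanSpace.single (Fin.last (m + 1)) t‖ ^ 2

theorem continuous_tiltedParaboloid {m : ℕ} (t : ℝ) :
    Continuous (tiltedParaboloid t : RSp (m + 2) → ℝ) := by
  have := (continuous_lastCoord (k := m)).comp continuous_initCoord
  unfold tiltedParaboloid
  exact this.add (by fun_prop)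

/-- The function is quadratic, so its second-order expansion is exact; this supplies the expansion
required by `truncKernel_curvature_ge`. -/
theorem tiltedParaboloid_add {m : ℕ} (t : ℝ) (x z : RSp (m + 2)) :
    tiltedParaboloid t (x + z) = tiltedParaboloid t x +
      inner ℝ (EuclideanSpace.single (Fin.last m).castSucc (1 : ℝ) +
        (2 : ℝ) • (x - EuclideanSpace.single (Fin.last (m + 1)) t)) z + ‖z‖ ^ 2 := by
  have h1 : lastCoord (initCoord (x + z)) = lastCoord (initCoord x) + z (Fin.last m).castSucc := rfl
  unfold tiltedParaboloid
  rw [h1, add_sub_right_comm, norm_add_sq_real, inner_add_left, real_inner_smul_left,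
    EuclideanSpace.inner_single_left]
  simp
  ring

theorem initCoord_single_last {k : ℕ} (t : ℝ) :
    initCoord (EuclideanSpace.single (Fin.last k) t) = 0 := by
  ext i
  simp [initCoord]

theorem lastCoord_single_last {k : ℕ} (t : ℝ) :
    lastCoord (EuclideanSpace.single (Fin.last k) t) = t := by
  simp [lastCoord]

theorem norm_initCoord_le_norm_sub_single {k : ℕ} (t : ℝ) (X : RSp (k + 1)) :
    ‖initCoord X‖ ≤ ‖X - EuclideanSpace.single (Fin.last k) t‖ := by
  have h := norm_initCoord_le (X - EuclideanSpace.single (Fin.last k) t)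
  rwa [initCoord_sub, initCoord_single_last, sub_zero] at h

theorem abs_lastCoord_sub_le_norm_sub_single {k : ℕ} (t : ℝ) (X : RSp (k + 1)) :
    |lastCoord X - t| ≤ ‖X - EuclideanSpace.single (Fin.last k) t‖ := by
  have h := abs_lastCoord_le (X - EuclideanSpace.single (Fin.last k) t)
  rwa [lastCoord_sub, lastCoord_single_last] at h

/-! ### The barrier at the cusp and the conclusion -/

/-- An `s`-minimal set with exterior data below height `0` is negligible near the points of
height larger than `ε` above a cuspidal boundary point, uniformly in the height. -/
theorem IsSMinimal.volume_inter_tiltedParaboloid_eq_zero {m : ℕ} (hm : 1 ≤ m) {s : ℝ}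
    (hs0 : 0 < s) (hs1 : s < 1) {ω : Set (RSp (m + 1))} (hω_open : IsOpen ω)
    {ρ : ℝ} (hρ : 0 < ρ) {φ : RSp m → ℝ} (hφ_nonneg : ∀ x', 0 ≤ φ x')
    {c β : ℝ} (hc : 0 < c) (hβ1 : β ≤ s + 1)
    (hφ : ∀ x' : RSp m, ‖x'‖ < ρ → c * ‖x'‖ ^ β ≤ φ x')
    (hω : ω ∩ ball 0 ρ = {x : RSp (m + 1) | φ (initCoord x) < lastCoord x} ∩ ball 0 ρ)
    {ψ : RSp (m + 1) → ℝ} (hψ : ∀ x ∈ ball (0 : RSp (m + 1)) ρ, ψ x ≤ 0)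
    {E : Set (RSp (m + 2))} (hE : IsSMinimal s E (vertCylinder ω))
    (hE_ext : E \ vertCylinder ω = subgraph ψ \ vertCylinder ω) {ε : ℝ} (hε : 0 < ε) :
    ∃ η : ℝ, 0 < η ∧ ∀ t, ε < t →
      volume (E ∩ {X | X ∈ vertCylinder ω ∧ initCoord X ∈ ball 0 ρ ∧
        tiltedParaboloid t X < η}) = 0 := by
  -- A coordinate of x', available because n = m + 1 ≥ 2; j is the direction of x_n.
  set i : Fin (m + 2) := (Fin.castSucc (Fin.castSucc ⟨0, hm⟩)) with hi
  set j : Fin (m + 2) := (Fin.last m).castSucc with hj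
  have hij : i ≠ j := by
    simp only [hi, hj, ne_eq, Fin.castSucc_inj]
    exact (Fin.castSucc_lt_last _).ne
  -- Points within 2r of (0, t) have positive height, since 2r ≤ ε < t, and lie over B_ρ and over
  -- the unit ball. Also r ≤ 1 / 2 keeps the gradient of the foliating function at least 1 / 2 in
  -- norm.
  set r : ℝ := min (min (ε / 2) (ρ / 2)) (1 / 2) with hr
  have hr0 : 0 < r := by positivity
  have hrε : r ≤ ε / 2 := (min_le_left _ _).trans (min_le_left _ _)
  have hrρ : r ≤ ρ / 2 := (min_le_left _ _).trans (min_le_right _ _)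
  have hr1 : r ≤ 1 / 2 := min_le_right _ _
  -- With |y'| ≥ |z_i| / 2, φ(y') is at least 2 c₁ |z_i|^(1+s): one half absorbs x_n, the other z_j.
  set c₁ : ℝ := c * (1 / 2) ^ (1 + s) / 2 with hc₁
  have hc₁0 : 0 < c₁ := by positivity
  have hM : (∫⁻ z in {z : RSp (m + 2) | r ≤ ‖z‖}, fracKernel s z) +
      (∫⁻ z in {z : RSp (m + 2) | |z i| ≤ 2 * ‖z‖ ^ 2 ∧ ‖z‖ < 1}, fracKernel s z) + 1 ≠ ∞ := by
    have h1 := (lintegral_fracKernel_compl_ball_lt_top (N := m + 2) hs0 hr0).ne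
    have h2 := (lintegral_fracKernel_thin_coord_lt_top hs0 hs1 i).ne
    simp [h1, h2]
  obtain ⟨h, hh, W, hWm, hW, hWint⟩ := exists_cusp_subset_lintegral_ge hs0 hc₁0 hij hr0 hM
  -- On the sublevel set, x_n and ‖x - p‖² are both below η. The first term of the minimum makes x_n
  -- < c₁ h^(1+s); the second makes ‖x - p‖ < h / 2, so |x_i| < |z_i| / 2 on the cusp, and ‖x - p‖ <
  -- r / 2.
  set η : ℝ := min (c₁ * h ^ (1 + s)) (min (h / 2) (r / 2) ^ 2) with hη
  refine ⟨η, by positivity, fun t ht => ?_⟩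
  set p : RSp (m + 2) := EuclideanSpace.single (Fin.last (m + 1)) t with hp
  set Ω : Set (RSp (m + 2)) := {X | X ∈ vertCylinder ω ∧ initCoord X ∈ ball 0 ρ ∧
    tiltedParaboloid t X < η} with hΩ
  set D : Set (RSp (m + 2)) := {X | X ∉ vertCylinder ω ∧ initCoord X ∈ ball 0 ρ ∧
    0 < lastCoord X} with hD
  have hcyl : IsOpen (vertCylinder ω) := isOpen_vertCylinder hω_open
  have hball_open : IsOpen {X : RSp (m + 2) | initCoord X ∈ ball 0 ρ} :=
    isOpen_vertCylinder isOpen_ball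
  have hΩ_open : IsOpen Ω :=
    hcyl.inter (hball_open.inter (isOpen_lt (continuous_tiltedParaboloid t) continuous_const))
  have hD_meas : MeasurableSet D := hcyl.measurableSet.compl.inter (hball_open.measurableSet.inter
    (measurableSet_lt measurable_const continuous_lastCoord.measurable))
  have hΩ_near : ∀ x ∈ Ω, lastCoord (initCoord x) < c₁ * h ^ (1 + s) ∧
      ‖x - p‖ < h / 2 ∧ ‖x - p‖ < r / 2 := by
    rintro x ⟨hx1, hx2, hx3⟩
    have hx : initCoord x ∈ ω ∩ ball 0 ρ := ⟨hx1, hx2⟩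
    rw [hω] at hx
    have hpos : 0 < lastCoord (initCoord x) := (hφ_nonneg _).trans_lt hx.1
    have hx3' : lastCoord (initCoord x) + ‖x - p‖ ^ 2 < η := hx3
    have h1 : η ≤ c₁ * h ^ (1 + s) := min_le_left _ _
    have h2 : η ≤ min (h / 2) (r / 2) ^ 2 := min_le_right _ _
    have h3 : ‖x - p‖ < min (h / 2) (r / 2) :=
      lt_of_pow_lt_pow_left₀ 2 (by positivity) (by linarith)
    exact ⟨by nlinarith [sq_nonneg ‖x - p‖], lt_min_iff.1 h3⟩
  have hΩ_bdd : Bornology.IsBounded Ω :=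
    isBounded_ball.subset fun x hx => mem_ball_iff_norm.2 (hΩ_near x hx).2.1
  have hDE : Disjoint D E := by
    rw [Set.disjoint_left]
    rintro y ⟨hy1, hy2, hy3⟩ hyE
    have : y ∈ subgraph ψ \ vertCylinder ω := hE_ext ▸ ⟨hyE, hy1⟩
    have h1 : lastCoord y < ψ (initCoord y) := this.1
    linarith [hψ _ hy2]
  have hnear : ∀ x ∈ Ω, ∀ z : RSp (m + 2), ‖z‖ < r →
      initCoord (x + z) ∈ ball 0 ρ ∧ 0 < lastCoord (x + z) ∧ ‖initCoord (x + z)‖ < 1 := by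
    intro x hx z hz
    have h1 : ‖x + z - p‖ < 2 * r := by
      calc ‖x + z - p‖ = ‖(x - p) + z‖ := by congr 1; abel
        _ ≤ ‖x - p‖ + ‖z‖ := norm_add_le _ _
        _ < 2 * r := by linarith [(hΩ_near x hx).2.2]
    have h2 := norm_initCoord_le_norm_sub_single t (x + z)
    have h3 := abs_lastCoord_sub_le_norm_sub_single t (x + z)
    rw [← hp] at h2 h3
    rw [abs_le] at h3
    refine ⟨?_, by linarith, by linarith⟩
    rw [mem_ball_zero_iff]
    linarith
  have hDmem : ∀ x ∈ Ω, ∀ z : RSp (m + 2), ‖z‖ < r → h < |z i| → |z j| ≤ c₁ * |z i| ^ (1 + s) →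
      x + z ∈ D := by
    intro x hx z hz hzi hzj
    obtain ⟨h1, h2, h3⟩ := hnear x hx z hz
    obtain ⟨hx1, hx2, -⟩ := hΩ_near x hx
    refine ⟨fun hmem => ?_, h1, h2⟩
    have hy : initCoord (x + z) ∈ ω ∩ ball 0 ρ := ⟨hmem, h1⟩
    rw [hω] at hy
    set y' := initCoord (initCoord (x + z)) with hy'
    have hy1 : φ y' < lastCoord (initCoord x) + z j := hy.1
    have hle : ‖y'‖ ≤ ‖initCoord (x + z)‖ := norm_initCoord_le _
    have hy1' : ‖y'‖ < 1 := hle.trans_lt h3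
    have hyρ : ‖y'‖ < ρ := hle.trans_lt (mem_ball_zero_iff.1 h1)
    have hxi : |x i| ≤ ‖x - p‖ := by
      have : (x - p) i = x i := by
        have : p i = 0 := by simp [hp, hi]
        simp [this]
      rw [← this]
      exact abs_coord_le_norm _ _
    have hyi : |z i| / 2 ≤ ‖y'‖ := by
      have hyi' : |x i + z i| ≤ ‖y'‖ := abs_coord_le_norm y' ⟨0, hm⟩
      have := abs_sub_abs_le_abs_sub (z i) (-x i)
      rw [abs_neg, sub_neg_eq_add, add_comm (z i)] at this
      linarith
    have hzi0 : 0 < |z i| := hh.trans hzi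
    have hy0 : 0 < ‖y'‖ := by linarith
    have hpow : c * (|z i| / 2) ^ (1 + s) ≤ φ y' := by
      refine le_trans ?_ (hφ y' hyρ)
      have e1 : (|z i| / 2) ^ (1 + s) ≤ ‖y'‖ ^ (1 + s) := by gcongr
      have e2 : ‖y'‖ ^ (1 + s) ≤ ‖y'‖ ^ β :=
        Real.rpow_le_rpow_of_exponent_ge hy0 hy1'.le (by linarith)
      gcongr
      exact e1.trans e2
    have hsplit : c * (|z i| / 2) ^ (1 + s) = 2 * (c₁ * |z i| ^ (1 + s)) := by
      rw [hc₁, div_eq_mul_one_div, Real.mul_rpow (abs_nonneg _) (by norm_num)]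
      ring
    have hhz : c₁ * h ^ (1 + s) ≤ c₁ * |z i| ^ (1 + s) := by gcongr
    linarith [le_abs_self (z j)]
  refine (hE.2 Ω hΩ_open hΩ_bdd fun x hx => hx.1).volume_inter_eq_zero hs0 hE.1
    hΩ_open.measurableSet hΩ_bdd.measure_lt_top hDE (continuous_tiltedParaboloid t).measurable hh
    fun x hx a ha hah => ?_
  refine truncKernel_curvature_ge i hD_meas hΩ_open.measurableSet hWm
    (continuous_tiltedParaboloid t).measurable
    (v := EuclideanSpace.single j (1 : ℝ) + (2 : ℝ) • (x - p)) ?_ (tiltedParaboloid_add t x)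
    (r := r) (by linarith) ?_ ?_ hWint
  · have h1 := norm_sub_le_norm_add (EuclideanSpace.single j (1 : ℝ)) ((2 : ℝ) • (x - p))
    rw [norm_smul, PiLp.norm_single, Real.norm_two, norm_one] at h1
    linarith [(hΩ_near x hx).2.2]
  · intro z hz hzD hu
    obtain ⟨h1, h2, -⟩ := hnear x hx z hz
    refine ⟨?_, h1, hu.trans_lt hx.2.2⟩
    by_contra hcon
    exact hzD ⟨hcon, h1, h2⟩
  · intro z hz
    obtain ⟨h1, h2, h3⟩ := hW z hz
    have hzi : |z i| = z i := abs_of_pos (hh.trans h1)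
    refine ⟨?_, hDmem x hx z h3 (by rwa [hzi]) (by rwa [hzi]), ?_⟩
    -- W lies where z_i > h, beyond every truncation radius a < h, so truncation costs none of its
    -- mass.
    · exact (hah.trans h1).trans_le ((le_abs_self _).trans (abs_coord_le_norm z i))
    · rw [sub_eq_add_neg]
      exact hDmem x hx (-z) (by rwa [norm_neg]) (by simpa [hzi] using h1)
        (by simpa [hzi] using h2)

theorem theorem1p3 (m : ℕ) (hm : 1 ≤ m) (s : ℝ) (hs0 : 0 < s) (hs1 : s < 1)
    (ω : Set (RSp (m + 1))) (hω_open : IsOpen ω) (hω_bdd : Bornology.IsBounded ω)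
    (ρ : ℝ) (hρ : 0 < ρ)
    (φ : RSp m → ℝ) (hφ_nonneg : ∀ x', 0 ≤ φ x') (hφ_zero : φ 0 = 0)
    (c β : ℝ) (hc : 0 < c) (hβ0 : 0 < β) (hβ1 : β ≤ s + 1)
    (hφ : ∀ x' : RSp m, ‖x'‖ < ρ → c * ‖x'‖ ^ β ≤ φ x')
    (hω : ω ∩ ball 0 ρ = {x : RSp (m + 1) | φ (initCoord x) < lastCoord x} ∩ ball 0 ρ)
    (ψ : RSp (m + 1) → ℝ) (hψ_loc : MemLinftyLoc ψ)
    (hψ : ∀ x ∈ ball (0 : RSp (m + 1)) ρ, ψ x ≤ 0)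
    (E : Set (RSp (m + 2))) (hE : IsSMinimal s E (vertCylinder ω))
    (hE_ext : E \ vertCylinder ω = subgraph ψ \ vertCylinder ω) :
    ∀ ε : ℝ, 0 < ε → ∃ δ : ℝ, 0 < δ ∧
      volume ((E ∩ vertCylinder (ball 0 δ)) \ {X : RSp (m + 2) | lastCoord X ≤ ε}) = 0 ∧
      (NoNegligiblePart E (vertCylinder ω) →
        E ∩ vertCylinder (ball 0 δ) ⊆ {X : RSp (m + 2) | lastCoord X ≤ ε}) := by
  intro ε hε
  obtain ⟨η, hη, hnull⟩ := hE.volume_inter_tiltedParaboloid_eq_zero hm hs0 hs1 hω_open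
    hρ hφ_nonneg hc hβ1 hφ hω hψ hE_ext hε
  -- Three terms below η / 4 keep the foliating function below η: x_n, ‖x‖² ≤ δ ‖x‖ with δ ≤ 1, and
  -- the squared height difference.
  set δ : ℝ := min ρ (min 1 (η / 4)) with hδ
  have hδ0 : 0 < δ := by positivity
  have hδρ : δ ≤ ρ := min_le_left _ _
  have hδ1 : δ ≤ 1 := (min_le_right _ _).trans (min_le_left _ _)
  have hδη : δ ≤ η / 4 := (min_le_right _ _).trans (min_le_right _ _)
  have hout : ∀ X ∈ (E ∩ vertCylinder (ball 0 δ)) \ {X : RSp (m + 2) | lastCoord X ≤ ε},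
      X ∈ vertCylinder ω := by
    rintro X ⟨⟨hXE, hXδ⟩, hXε⟩
    by_contra hcon
    have h1 : X ∈ subgraph ψ \ vertCylinder ω := hE_ext ▸ ⟨hXE, hcon⟩
    have h2 : lastCoord X < ψ (initCoord X) := h1.1
    exact hXε (by linarith [hψ _ (ball_subset_ball hδρ hXδ)] : lastCoord X ≤ ε)
  have hsub : (E ∩ vertCylinder (ball 0 δ)) \ {X : RSp (m + 2) | lastCoord X ≤ ε} ⊆
      ⋃ q : {q : ℚ // ε < q}, E ∩ {X | X ∈ vertCylinder ω ∧ initCoord X ∈ ball 0 ρ ∧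
        tiltedParaboloid (q : ℝ) X < η} := by
    intro X hX
    have hXω := hout X hX
    obtain ⟨⟨hXE, hXδ⟩, hXε⟩ := hX
    have hXε : ε < lastCoord X := not_le.1 hXε
    have hXδ' : ‖initCoord X‖ < δ := mem_ball_zero_iff.1 hXδ
    have hsqrt : 0 < √η := Real.sqrt_pos.2 hη
    -- Rational centres make the cover countable.
    obtain ⟨q, hq1, hq2⟩ := exists_rat_btwn
      (max_lt hXε (by linarith : lastCoord X - √η / 2 < lastCoord X))
    rw [max_lt_iff] at hq1
    refine mem_iUnion.2 ⟨⟨q, hq1.1⟩, hXE, hXω, ball_subset_ball hδρ hXδ, ?_⟩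
    unfold tiltedParaboloid
    rw [norm_sq_eq_initCoord_add_lastCoord, initCoord_sub, lastCoord_sub, initCoord_single_last,
      lastCoord_single_last, sub_zero]
    have h1 : lastCoord (initCoord X) < η / 4 :=
      ((le_abs_self _).trans (abs_lastCoord_le _)).trans_lt (hXδ'.trans_le hδη)
    have h2 : ‖initCoord X‖ ^ 2 < η / 4 := by
      nlinarith [norm_nonneg (initCoord X)]
    have h3 : (lastCoord X - q) ^ 2 < η / 4 := by
      have : (√η / 2) ^ 2 = η / 4 := by rw [div_pow, Real.sq_sqrt hη.le]; norm_num
      rw [← this]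
      exact pow_lt_pow_left₀ (by linarith) (by linarith) (by norm_num)
    linarith
  have hvol : volume ((E ∩ vertCylinder (ball 0 δ)) \
      {X : RSp (m + 2) | lastCoord X ≤ ε}) = 0 :=
    measure_mono_null hsub (measure_iUnion_null fun q => hnull q q.2)
  refine ⟨δ, hδ0, hvol, fun hrep X hX => ?_⟩
  by_contra hXε
  have hXε' : ε < lastCoord X := not_le.1 hXε
  have hXω := hout X ⟨hX, hXε⟩
  -- An offending point has a whole ball inside this open set, where E is null, against the choice
  -- of representative.
  have hopen : IsOpen (vertCylinder (ball 0 δ) ∩ {X : RSp (m + 2) | ε < lastCoord X}) :=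
    (isOpen_vertCylinder isOpen_ball).inter (isOpen_lt continuous_const continuous_lastCoord)
  obtain ⟨r, hr, hball⟩ := Metric.isOpen_iff.1 hopen X ⟨hX.2, hXε'⟩
  refine (hrep X ⟨hX.1, hXω⟩ r hr).ne' (measure_mono_null ?_ hvol)
  rintro Y ⟨hYE, hYr⟩
  have hYε : ε < lastCoord Y := (hball hYr).2
  exact ⟨⟨hYE, (hball hYr).1⟩, not_le.2 hYε⟩
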